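/- All graphs are simple and possibly infinite. A graph is \emph{chordal} if each of its cycles of length at least $4$ has a chord, \emph{$r$-chordal} if each of its cycles of length at least $4$ and at most $r$ has a chord, and \emph{wheel-free} if for no $n\ge 4$ it contains the wheel $W_n$ (a cycle of length $n$ together with a further vertex adjacent to all its vertices) as an induced subgraph. A \emph{covering} of a graph $G$ is a surjective graph homomorphism $p\colon \hat G\to G$ that, for every vertex $\hat v$ of $\hat G$, restricts to a bijection from the edges incident to $\hat v$ to the edges incident to $p(\hat v)$, and such that the preimage of every component of $G$ is connected. The \emph{ball} $B_G(v,r/2)$ is the subgraph of $G$ formed by all vertices at distance at most $r/2$ from $v$ and all edges of $G$ whose endpoints' distances to $v$ sum to strictly less than $r$. A homomorphism $p\colon\hat G\to G$ is \emph{$r/2$-ball-preserving} if for every vertex $\hat v$ of $\hat G$ it restricts to an isomorphism from $B_{\hat G}(\hat v,r/2)$ to $B_G(p(\hat v),r/2)$. The \emph{$r$-local covering} $p_r\colon G_r\to G$ is the universal $r/2$-ball-preserving covering of $G$: it is an $r/2$-ball-preserving covering, and for every $r/2$-ball-preserving covering $p\colon\hat G\to G$ there is a covering $q\colon G_r\to\hat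 G$ with $p_r=p\circ q$. The graph $G_r$ is the \emph{$r$-local cover} of $G$. \textbf{Theorem.} Let $G$ be a graph and let $r\ge 3$ be an integer. Then $G$ has an $r$-local covering, and the $r$-local cover $G_r$ of $G$ is chordal if and only if $G_r$ is $r$-chordal and wheel-free. -/

import Mathlib

universe u v

namespace LocalCover

open SimpleGraph

/-- A graph is chordal if each of its cycles of length at least four has a chord. -/
def IsChordal {V : Type u} (G : SimpleGraph V) : Prop :=
  ∀ (x : V) (c : G.Walk x x), c.IsCycle → 4 ≤ c.length → ∃ e : Sym2 V, c.IsChord e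

/-- A graph is `r`-chordal if each of its cycles of length at least four and at most `r`
has a chord. -/
def IsChordalUpTo {V : Type u} (r : ℕ) (G : SimpleGraph V) : Prop :=
  ∀ (x : V) (c : G.Walk x x), c.IsCycle → 4 ≤ c.length → c.length ≤ r →
    ∃ e : Sym2 V, c.IsChord e

/-- The wheel `W_n`: the rim is the cycle `cycleGraph n` on the vertices `some i`, and the hub
`none` is adjacent to every vertex of the rim. -/
def wheel (n : ℕ) : SimpleGraph (Option (Fin n)) where
  Adj
    | none, none => False
    | none, some _ => True
    | some _, none => True
    | some i, some j => (cycleGraph n).Adj i j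
  symm := ⟨by
    rintro (_ | i) (_ | j) h
    · exact h
    · trivial
    · trivial
    · exact SimpleGraph.Adj.symm h⟩
  loopless := ⟨by
    rintro (_ | i) h
    · exact h
    · exact (cycleGraph n).loopless.irrefl i h⟩

/-- A graph is wheel-free if no wheel `W_n` with `n ≥ 4` is an induced subgraph of it. -/
def IsWheelFree {V : Type u} (G : SimpleGraph V) : Prop :=
  ∀ n : ℕ, 4 ≤ n → ¬ (wheel n).IsIndContained G

/-- The ball of radius `r / 2` around `x`: the subgraph of `G` formed by the vertices of distance
at most `r / 2` from `x` and the edges whose endpoints' distances to `x` sum to less than `r`.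
Distances are extended (`⊤` between different components). -/
def ball {V : Type u} (G : SimpleGraph V) (x : V) (r : ℕ) : G.Subgraph where
  verts := {a | 2 * G.edist x a ≤ (r : ℕ∞)}
  Adj a b := G.Adj a b ∧ G.edist x a + G.edist x b < (r : ℕ∞)
  adj_sub h := h.1
  edge_vert {a b} h := by
    obtain ⟨hab, hlt⟩ := h
    have h1 : G.edist x a ≤ G.edist x b + 1 := by
      calc G.edist x a ≤ G.edist x b + G.edist b a := G.edist_triangle
        _ = G.edist x b + 1 := by rw [SimpleGraph.edist_eq_one_iff_adj.2 hab.symm]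
    have h2 : G.edist x a + G.edist x b + 1 ≤ (r : ℕ∞) := Order.add_one_le_of_lt hlt
    calc 2 * G.edist x a = G.edist x a + G.edist x a := two_mul _
      _ ≤ G.edist x a + (G.edist x b + 1) := by gcongr
      _ ≤ (r : ℕ∞) := by rw [← add_assoc]; exact h2
  symm := ⟨fun a b h => ⟨h.1.symm, by rw [add_comm]; exact h.2⟩⟩

/-- A homomorphism `p : H → G` is `r / 2`-ball-preserving if, for every vertex `y` of `H`, it
restricts to an isomorphism from the ball of radius `r / 2` around `y` to the ball of radius
`r / 2` around `p y`. -/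
def IsBallPreserving {V : Type u} {W : Type v} {G : SimpleGraph V} {H : SimpleGraph W} (r : ℕ)
    (p : H →g G) : Prop :=
  ∀ y : W, Set.BijOn p (ball H y r).verts (ball G (p y) r).verts ∧
    ∀ a ∈ (ball H y r).verts, ∀ b ∈ (ball H y r).verts,
      (ball H y r).Adj a b ↔ (ball G (p y) r).Adj (p a) (p b)

/-- A covering of a simple graph: a surjective homomorphism that restricts, at every vertex `y`,
to a bijection from the edges at `y` to the edges at `p y` (for simple graphs: from the neighbours
of `y` to the neighbours of `p y`), and under which the preimage of every component is
connected. -/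
structure IsCovering {V : Type u} {W : Type v} {G : SimpleGraph V} {H : SimpleGraph W}
    (p : H →g G) : Prop where
  surjective : Function.Surjective p
  bijOn_neighborSet : ∀ y : W, Set.BijOn p (H.neighborSet y) (G.neighborSet (p y))
  connected_preimage : ∀ C : G.ConnectedComponent, (H.induce (p ⁻¹' C.supp)).Connected

/-- `p : H → G` is an `r`-local covering of `G`, and `H` an `r`-local cover of `G`: the universal
`r / 2`-ball-preserving covering of `G`. Since a covering in the above sense has, over every
component of `G`, at most as many vertices as there are walks in this component, every covering of
`G` has an isomorphic copy in the universe of the vertices of `G`. -/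
structure IsLocalCovering {V : Type u} {W : Type v} {G : SimpleGraph V} {H : SimpleGraph W}
    (r : ℕ) (p : H →g G) : Prop where
  isCovering : IsCovering p
  isBallPreserving : IsBallPreserving r p
  universal : ∀ (U : Type u) (K : SimpleGraph U) (p' : K →g G),
    IsCovering p' → IsBallPreserving r p' → ∃ q : H →g K, IsCovering q ∧ p'.comp q = p

end LocalCover

/-! Existence. For a locally bijective homomorphism, preserving `r / 2`-balls is the same as the
lifting condition `IsShortClosed`: a walk of length at most `r` whose ends have the same image is
closed. A covering with this property depends only on walks modulo closed walks of length at most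
`r`, so classes of walks from a root in each component form the universal one
(`universalProj_isLocalCovering`). Consequently, closed walks of any local cover project to
null-homotopic walks.

Chordality. A chordal graph is wheel-free because the rim of an induced wheel is a chordless cycle.
The converse direction is cohomological. A chordless cycle of length at least 4 has an edge in no
triangle of its induced subgraph, so an integer function supported on that edge is a cocycle there,
with sum 1 around the cycle. Wheel-freeness extends it to a cocycle on the whole graph
(`PartialCocycle.exists_extension`): neighbourhoods induce chordal graphs, on which cocycles are
gradients, so vertices can be added one at a time. By `r`-chordality the extension sums to zero
along closed walks of length at most `r` (`walkSum_eq_zero_of_isChordalUpTo`). The associated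
voltage graph then satisfies the lifting condition over the base, and null-homotopy forces zero sum
along every closed walk (`IsLocalCovering.walkSum_eq_zero`), contradicting the sum 1. -/

namespace LocalCover

open SimpleGraph

/-! ### Lifting walks along locally bijective homomorphisms. -/

section Lifting

variable {V W : Type*} {G : SimpleGraph V} {H : SimpleGraph W} {p : H →g G}

/-- A homomorphism is locally bijective if it restricts to bijections between the neighbourhoods. -/
def IsLocallyBijective (p : H →g G) : Prop :=
  ∀ y : W, Set.BijOn p (H.neighborSet y) (G.neighborSet (p y))

/-- Walks of length at most `r` whose endpoints have the same image are closed. -/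
def IsShortClosed (r : ℕ) (p : H →g G) : Prop :=
  ∀ (y z : W) (w : H.Walk y z), w.length ≤ r → p y = p z → y = z

theorem IsLocallyBijective.exists_adj (hp : IsLocallyBijective p) {a b : V} (h : G.Adj a b)
    (y : p ⁻¹' {a}) : ∃ z : p ⁻¹' {b}, H.Adj y z := by
  obtain ⟨y, rfl⟩ := y
  obtain ⟨z, hz, hzb⟩ := (hp y).surjOn h
  exact ⟨⟨z, hzb⟩, hz⟩

theorem IsLocallyBijective.eq_of_adj (hp : IsLocallyBijective p) {y z z' : W} (h : H.Adj y z)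
    (h' : H.Adj y z') (e : p z = p z') : z = z' :=
  (hp y).injOn h h' e

/-- The endpoint of the lift of a walk to a given start vertex. -/
noncomputable def endpoint (hp : IsLocallyBijective p) :
    ∀ {a b : V}, G.Walk a b → p ⁻¹' {a} → p ⁻¹' {b}
  | _, _, .nil, y => y
  | _, _, .cons h w, y => endpoint hp w (hp.exists_adj h y).choose

variable (hp : IsLocallyBijective p)

@[simp]
theorem endpoint_nil {a : V} (y : p ⁻¹' {a}) : endpoint hp (.nil : G.Walk a a) y = y := rfl

theorem endpoint_cons {a b c : V} (h : G.Adj a b) (w : G.Walk b c) (y : p ⁻¹' {a})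
    (z : p ⁻¹' {b}) (hz : H.Adj y z) : endpoint hp (.cons h w) y = endpoint hp w z := by
  have : (hp.exists_adj h y).choose = z :=
    Subtype.ext (hp.eq_of_adj (hp.exists_adj h y).choose_spec hz
      ((hp.exists_adj h y).choose.2.trans z.2.symm))
  rw [← this]
  rfl

theorem endpoint_append {a b c : V} (w : G.Walk a b) (w' : G.Walk b c) (y : p ⁻¹' {a}) :
    endpoint hp (w.append w') y = endpoint hp w' (endpoint hp w y) := by
  induction w with
  | nil => rfl
  | cons h w ih => exact ih w' _

theorem exists_walk_endpoint {a b : V} (w : G.Walk a b) (y : p ⁻¹' {a}) :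
    ∃ v : H.Walk y (endpoint hp w y), v.length = w.length := by
  induction w with
  | nil => exact ⟨.nil, rfl⟩
  | cons h w ih =>
    obtain ⟨v, hv⟩ := ih (hp.exists_adj h y).choose
    exact ⟨.cons (hp.exists_adj h y).choose_spec v, congrArg (· + 1) hv⟩

theorem endpoint_map {y z : W} (v : H.Walk y z) :
    endpoint hp (v.map p) ⟨y, rfl⟩ = ⟨z, rfl⟩ := by
  induction v with
  | nil => rfl
  | cons h v ih => exact (endpoint_cons hp _ _ _ ⟨_, rfl⟩ h).trans ih

theorem adj_endpoint_concat {a b c : V} (w : G.Walk a b) (h : G.Adj b c) (y : p ⁻¹' {a}) :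
    H.Adj (endpoint hp w y) (endpoint hp (w.concat h) y) := by
  rw [Walk.concat_eq_append, endpoint_append]
  exact (hp.exists_adj h (endpoint hp w y)).choose_spec

end Lifting

/-! ### Coverings, and ball preservation as a lifting condition. -/

section Covering

variable {V W : Type*} {G : SimpleGraph V} {H : SimpleGraph W} {p : H →g G}

theorem reachable_induce_of_walk {s : Set W} (hs : ∀ a ∈ s, ∀ b, H.Adj a b → b ∈ s) {x y : W}
    (w : H.Walk x y) (hx : x ∈ s) (hy : y ∈ s) : (H.induce s).Reachable ⟨x, hx⟩ ⟨y, hy⟩ := by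
  induction w with
  | nil => rfl
  | cons h w ih =>
    have hm := hs _ hx _ h
    exact (Adj.reachable (G := H.induce s) (u := ⟨_, hx⟩) (v := ⟨_, hm⟩) h).trans (ih hm hy)

theorem isCovering_iff {V : Type u} {W : Type v} {G : SimpleGraph V} {H : SimpleGraph W}
    {p : H →g G} : IsCovering p ↔ Function.Surjective p ∧ IsLocallyBijective p ∧
      ∀ x y, G.Reachable (p x) (p y) → H.Reachable x y := by
  refine ⟨fun h => ⟨h.1, h.2, fun x y hxy => ?_⟩, fun ⟨h1, h2, h3⟩ => ⟨h1, h2, fun C => ?_⟩⟩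
  · have hc := h.3 (G.connectedComponentMk (p x))
    have := hc.preconnected ⟨x, rfl⟩ ⟨y, (ConnectedComponent.eq.2 hxy).symm⟩
    exact this.map (Embedding.induce _).toHom
  · have : ∀ a ∈ p ⁻¹' C.supp, ∀ b, H.Adj a b → b ∈ p ⁻¹' C.supp := fun a ha b hab =>
      (ConnectedComponent.eq.2 (p.map_adj hab).symm.reachable).trans ha
    refine { preconnected := fun x y => ?_, nonempty := ?_ }
    · obtain ⟨w⟩ := h3 x y (ConnectedComponent.eq.1 (x.2.trans y.2.symm))
      exact reachable_induce_of_walk this w x.2 y.2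
    · obtain ⟨a, ha⟩ := C.nonempty_supp
      obtain ⟨x, rfl⟩ := h1 a
      exact ⟨x, ha⟩

/-- Local bijectivity cancels. For surjectivity, a point of the image over the same base vertex is
joined to the target by a walk, which lifts along `q`. -/
theorem IsCovering.of_comp {U : Type*} {K : SimpleGraph U} {p' : K →g G} {q : H →g K}
    (hp : IsCovering p) (hp' : IsCovering p') (h : p'.comp q = p) : IsCovering q := by
  subst h
  rw [isCovering_iff] at *
  obtain ⟨hs, hb, hr⟩ := hp
  obtain ⟨hs', hb', hr'⟩ := hp'
  have hq : IsLocallyBijective q := fun y => by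
    refine ⟨fun z hz => q.map_adj hz, fun z hz z' hz' e => ?_, fun z hz => ?_⟩
    · exact hb.eq_of_adj hz hz' (congrArg p' e)
    · obtain ⟨x, hx, e⟩ := (hb y).surjOn (p'.map_adj hz)
      exact ⟨x, hx, hb'.eq_of_adj (q.map_adj hx) hz e⟩
  refine ⟨fun z => ?_, hq, fun x y hxy => hr x y (hxy.map p')⟩
  obtain ⟨x, hx⟩ := hs (p' z)
  obtain ⟨w⟩ := hr' (q x) z (by rw [← hx]; rfl)
  exact ⟨endpoint hq w ⟨x, rfl⟩, (endpoint hq w ⟨x, rfl⟩).2⟩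

theorem exists_walk_of_two_mul_edist_le {x y z : V} {r : ℕ} (hy : 2 * G.edist x y ≤ r)
    (hz : 2 * G.edist x z ≤ r) : ∃ w : G.Walk y z, w.length ≤ r := by
  have aux : ∀ a, 2 * G.edist x a ≤ r → ∃ w : G.Walk x a, 2 * w.length ≤ r := fun a ha => by
    have : G.edist x a ≠ ⊤ := fun h => by simp [h] at ha
    obtain ⟨w, hw⟩ := exists_walk_of_edist_ne_top this
    exact ⟨w, by rw [← hw] at ha; exact_mod_cast ha⟩
  obtain ⟨w, hw⟩ := aux y hy
  obtain ⟨w', hw'⟩ := aux z hz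
  exact ⟨w.reverse.append w', by simp; omega⟩

theorem edist_map_le (p : H →g G) (x y : W) : G.edist (p x) (p y) ≤ H.edist x y := by
  by_cases h : H.edist x y = ⊤
  · simp [h]
  · obtain ⟨w, hw⟩ := exists_walk_of_edist_ne_top h
    rw [← hw]
    simpa using (w.map p).edist_le

/-- The lift of a shortest walk from `p x` to `p y` ends within `r / 2` of `x`, over `p y`. So does
`y`, hence the two ends coincide. -/
theorem IsShortClosed.edist_eq {r : ℕ} (hb : IsLocallyBijective p) (h : IsShortClosed r p)
    {x y : W} (hy : 2 * H.edist x y ≤ r) : G.edist (p x) (p y) = H.edist x y := by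
  refine le_antisymm (edist_map_le p x y) ?_
  have hd : 2 * G.edist (p x) (p y) ≤ r := (mul_le_mul_right (edist_map_le p x y) 2).trans hy
  obtain ⟨w, hw⟩ := exists_walk_of_edist_ne_top (G := G) (u := p x) (v := p y)
    (fun h => by simp [h] at hd)
  obtain ⟨v, hv⟩ := exists_walk_endpoint hb w ⟨x, rfl⟩
  have h2 : 2 * H.edist x (endpoint hb w ⟨x, rfl⟩) ≤ r := by
    refine (mul_le_mul_right v.edist_le 2).trans ?_
    rwa [hv, hw]
  obtain ⟨t, ht⟩ := exists_walk_of_two_mul_edist_le hy h2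
  have := h _ _ t ht (endpoint hb w ⟨x, rfl⟩).2.symm
  calc H.edist x y = H.edist x (endpoint hb w ⟨x, rfl⟩) := by rw [← this]
    _ ≤ v.length := v.edist_le
    _ = _ := by rw [hv, hw]

theorem IsShortClosed.isBallPreserving {V : Type u} {W : Type v} {G : SimpleGraph V}
    {H : SimpleGraph W} {p : H →g G} {r : ℕ} (hb : IsLocallyBijective p)
    (h : IsShortClosed r p) : IsBallPreserving r p := by
  intro y
  refine ⟨⟨fun a ha => ?_, fun a ha b hb' e => ?_, fun b hb' => ?_⟩, fun a ha b hb' => ?_⟩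
  · exact (mul_le_mul_right (edist_map_le p y a) 2).trans ha
  · obtain ⟨t, ht⟩ := exists_walk_of_two_mul_edist_le ha hb'
    exact h _ _ t ht e
  · obtain ⟨w, hw⟩ := exists_walk_of_edist_ne_top (G := G) (u := p y) (v := b)
      (fun h => by simp [ball, h] at hb')
    obtain ⟨v, hv⟩ := exists_walk_endpoint hb w ⟨y, rfl⟩
    refine ⟨_, ?_, (endpoint hb w ⟨y, rfl⟩).2⟩
    refine (mul_le_mul_right v.edist_le 2).trans ?_
    rw [hv, hw]
    exact hb'
  · refine ⟨fun hab => ⟨p.map_adj hab.1, (add_le_add (edist_map_le p y a)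
      (edist_map_le p y b)).trans_lt hab.2⟩, fun ⟨hab, hlt⟩ => ?_⟩
    rw [h.edist_eq hb ha, h.edist_eq hb hb'] at hlt
    refine ⟨?_, hlt⟩
    obtain ⟨b', hab', e⟩ := (hb a).surjOn hab
    obtain ⟨wa, hwa⟩ := exists_walk_of_edist_ne_top (G := H) (u := y) (v := a)
      (fun h => by simp [h] at hlt)
    obtain ⟨wb, hwb⟩ := exists_walk_of_edist_ne_top (G := H) (u := y) (v := b)
      (fun h => by simp [h] at hlt)
    have hl : wa.length + wb.length < r := by rw [← hwa, ← hwb] at hlt; exact_mod_cast hlt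
    -- The walk from `b'` through `a` and `y` to `b` has length at most `r` because the edge
    -- condition of the ball is strict.
    have : b' = b := h _ _ ((Walk.cons (H.adj_symm hab') wa.reverse).append wb)
      (by simp; omega) e
    exact this ▸ hab'

/-- Consider the ball around the middle of the walk. Even length is settled by injectivity on
vertices. For odd length, the last edge is removed and the edges of the ball are used. -/
theorem IsBallPreserving.isShortClosed {V : Type u} {W : Type v} {G : SimpleGraph V}
    {H : SimpleGraph W} {p : H →g G} {r : ℕ} (hb : IsLocallyBijective p)
    (h : IsBallPreserving r p) : IsShortClosed r p := by
  have half : ∀ (m : ℕ) (_ : 2 * m ≤ r) (y z : W) (w : H.Walk y z), w.length = 2 * m →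
      ∃ x : W, H.edist x y ≤ m ∧ H.edist x z ≤ m := fun m _ y z w hw => by
    refine ⟨w.getVert m, ?_, ?_⟩
    · rw [edist_comm]
      refine (w.take m).edist_le.trans ?_
      simp
    · refine (w.drop m).edist_le.trans ?_
      simp; exact_mod_cast (by omega)
  have dbl : ∀ (m : ℕ) (_ : 2 * m ≤ r) (x y : W), H.edist x y ≤ m → 2 * H.edist x y ≤ r :=
    fun m hm x y hd => (mul_le_mul_right hd 2).trans (by exact_mod_cast hm)
  intro y z w hw e
  rcases Nat.even_or_odd' w.length with ⟨m, hm | hm⟩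
  · obtain ⟨x, hy, hz⟩ := half m (by omega) y z w hm
    exact (h x).1.injOn (dbl m (by omega) _ _ hy) (dbl m (by omega) _ _ hz) e
  · obtain ⟨t, w', hw', ht⟩ : ∃ (t : W) (w' : H.Walk y t), w'.length = 2 * m ∧ H.Adj t z :=
      ⟨w.penultimate, w.dropLast, by simp [hm], w.adj_penultimate (by
        rw [Walk.not_nil_iff_lt_length]; omega)⟩
    obtain ⟨x, hy, hz⟩ := half m (by omega) y t w' hw'
    have hadj : (ball G (p x) r).Adj (p t) (p y) := by
      refine ⟨by rw [e]; exact p.map_adj ht, ?_⟩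
      calc _ ≤ (m : ℕ∞) + m := add_le_add ((edist_map_le p _ _).trans hz)
            ((edist_map_le p _ _).trans hy)
        _ < r := by exact_mod_cast (by omega)
    have := ((h x).2 t (dbl m (by omega) _ _ hz) y (dbl m (by omega) _ _ hy)).2 hadj
    exact hb.eq_of_adj this.1 ht e

end Covering

/-! ### Homotopy of walks modulo short closed walks. -/

section Homotopy

variable {V W : Type*} {G : SimpleGraph V} {H : SimpleGraph W} {p : H →g G} {r : ℕ}

/-- The congruence on walks generated by the closed walks of length at most `r`. -/
inductive ShortHomotopic (r : ℕ) : ∀ {a b : V}, G.Walk a b → G.Walk a b → Prop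
  | short {a b : V} (w w' : G.Walk a b) : w.length + w'.length ≤ r → ShortHomotopic r w w'
  | refl {a b : V} (w : G.Walk a b) : ShortHomotopic r w w
  | symm {a b : V} {w w' : G.Walk a b} : ShortHomotopic r w w' → ShortHomotopic r w' w
  | trans {a b : V} {w w' w'' : G.Walk a b} :
      ShortHomotopic r w w' → ShortHomotopic r w' w'' → ShortHomotopic r w w''
  | append {a b c : V} {w w' : G.Walk a b} {t t' : G.Walk b c} :
      ShortHomotopic r w w' → ShortHomotopic r t t' →
        ShortHomotopic r (w.append t) (w'.append t')

/-- For a generator, one lift reversed and followed by the other has length at most `r`, and its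
ends have the same image. -/
theorem ShortHomotopic.endpoint_eq (hb : IsLocallyBijective p) (hs : IsShortClosed r p) {a b : V}
    {w w' : G.Walk a b} (h : ShortHomotopic r w w') (y : p ⁻¹' {a}) :
    endpoint hb w y = endpoint hb w' y := by
  induction h with
  | short w w' h =>
    obtain ⟨v, hv⟩ := exists_walk_endpoint hb w y
    obtain ⟨v', hv'⟩ := exists_walk_endpoint hb w' y
    refine Subtype.ext (hs _ _ (v.reverse.append v') (by simpa [hv, hv']) ?_)
    exact (endpoint hb w y).2.trans (endpoint hb w' y).2.symm
  | refl => rfl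
  | symm _ ih => exact (ih y).symm
  | trans _ _ ih ih' => exact (ih y).trans (ih' y)
  | append _ _ ih ih' => rw [endpoint_append, endpoint_append, ih, ih']

theorem ShortHomotopic.reverse_append_self (hr : 2 ≤ r) {a b : V} (w : G.Walk a b) :
    ShortHomotopic r (w.reverse.append w) .nil := by
  induction w with
  | nil => exact .refl _
  | cons h w ih =>
    have h1 : ShortHomotopic r (Walk.cons h.symm (Walk.cons h .nil)) .nil := .short _ _ (by simpa)
    have := (ShortHomotopic.refl (r := r) w.reverse).append (h1.append (.refl w))
    simp only [Walk.cons_append, Walk.nil_append] at this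
    simpa [← Walk.append_assoc] using this.trans ih

theorem ShortHomotopic.nil_of_append (hr : 2 ≤ r) {a b : V} {w : G.Walk a b} {t : G.Walk b b}
    (h : ShortHomotopic r w (w.append t)) : ShortHomotopic r t .nil := by
  have h3 := ((ShortHomotopic.refl w.reverse).append h).symm
  rw [Walk.append_assoc] at h3
  exact (((reverse_append_self hr w).append (.refl t)).symm.trans h3).trans
    (.reverse_append_self hr w)

end Homotopy

/-! ### Construction and universality of the local cover. -/

section Universal

variable {V : Type u} {G : SimpleGraph V}

/-- A chosen vertex of a component. -/
noncomputable def root (C : G.ConnectedComponent) : V := Quot.out C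

variable (G) (r : ℕ)

/-- The vertices of the universal short-closed covering: classes of walks from the chosen roots of
the components. -/
structure UniversalVertex : Type u where
  /-- The component. -/
  component : G.ConnectedComponent
  /-- The end vertex. -/
  vertex : V
  /-- The class of walks. -/
  walkClass : Quot (ShortHomotopic r : G.Walk (root component) vertex → _ → Prop)

variable {G}

/-- The vertex of the universal short-closed covering given by a walk. -/
def UniversalVertex.ofWalk {C : G.ConnectedComponent} {b : V} (w : G.Walk (root C) b) :
    UniversalVertex G r :=
  ⟨C, b, Quot.mk _ w⟩

variable {r}

theorem UniversalVertex.exists_eq_ofWalk (x : UniversalVertex G r) :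
    ∃ (C : G.ConnectedComponent) (b : V) (w : G.Walk (root C) b), x = .ofWalk r w := by
  obtain ⟨C, b, ⟨w⟩⟩ := x
  exact ⟨C, b, w, rfl⟩

theorem shortHomotopic_of_quot_eq {a b : V} {w w' : G.Walk a b}
    (h : Quot.mk (ShortHomotopic r) w = Quot.mk (ShortHomotopic r) w') :
    ShortHomotopic r w w' := by
  replace h := Quot.eqvGen_exact h
  induction h with
  | rel _ _ h => exact h
  | refl => exact .refl _
  | symm _ _ _ ih => exact ih.symm
  | trans _ _ _ _ _ ih ih' => exact ih.trans ih'

theorem UniversalVertex.ofWalk_eq_ofWalk_iff {C : G.ConnectedComponent} {b : V}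
    {w w' : G.Walk (root C) b} : ofWalk r w = ofWalk r w' ↔ ShortHomotopic r w w' := by
  refine ⟨fun h => shortHomotopic_of_quot_eq ?_, fun h => ?_⟩
  · simpa [ofWalk] using h
  · rw [ofWalk, ofWalk, Quot.sound h]

theorem UniversalVertex.ofWalk_eq_ofWalk {C C' : G.ConnectedComponent} {b b' : V}
    {w : G.Walk (root C) b} {w' : G.Walk (root C') b'} (h : ofWalk r w = ofWalk r w') :
    C = C' ∧ b = b' :=
  ⟨congrArg component h, congrArg vertex h⟩

theorem concat_concat_shortHomotopic (hr : 2 ≤ r) {a b c : V} (w : G.Walk a b) (h : G.Adj b c) :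
    ShortHomotopic r ((w.concat h).concat h.symm) w := by
  have h1 : ShortHomotopic r (Walk.cons h (Walk.cons h.symm .nil)) .nil := .short _ _ (by simpa)
  have := (ShortHomotopic.refl (r := r) w).append h1
  simpa [Walk.concat_eq_append, ← Walk.append_assoc] using this

theorem ShortHomotopic.concat {a b c : V} {w w' : G.Walk a b} (h : ShortHomotopic r w w')
    (hbc : G.Adj b c) : ShortHomotopic r (w.concat hbc) (w'.concat hbc) := by
  simpa only [Walk.concat_eq_append] using h.append (.refl _)

variable (G) in
/-- The universal short-closed covering graph. -/
def universalCover (hr : 2 ≤ r) : SimpleGraph (UniversalVertex G r) where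
  Adj x y := ∃ (C : G.ConnectedComponent) (b c : V) (w : G.Walk (root C) b) (h : G.Adj b c),
    x = .ofWalk r w ∧ y = .ofWalk r (w.concat h)
  symm := ⟨by
    rintro _ _ ⟨C, b, c, w, h, rfl, rfl⟩
    exact ⟨C, c, b, w.concat h, h.symm, rfl,
      UniversalVertex.ofWalk_eq_ofWalk_iff.2 (concat_concat_shortHomotopic hr w h).symm⟩⟩
  loopless := ⟨by
    rintro _ ⟨C, b, c, w, h, rfl, e⟩
    exact h.ne (UniversalVertex.ofWalk_eq_ofWalk e).2⟩

theorem universalCover_adj_ofWalk (hr : 2 ≤ r) {C : G.ConnectedComponent} {b : V}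
    (w : G.Walk (root C) b) (y : UniversalVertex G r) :
    (universalCover G hr).Adj (.ofWalk r w) y ↔
      ∃ (c : V) (h : G.Adj b c), y = .ofWalk r (w.concat h) := by
  refine ⟨?_, fun ⟨c, h, e⟩ => ⟨C, b, c, w, h, rfl, e⟩⟩
  rintro ⟨C', b', c, w', h, e, rfl⟩
  obtain ⟨rfl, rfl⟩ := UniversalVertex.ofWalk_eq_ofWalk e
  exact ⟨c, h, UniversalVertex.ofWalk_eq_ofWalk_iff.2
    ((UniversalVertex.ofWalk_eq_ofWalk_iff.1 e).symm.concat h)⟩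

variable (G) in
/-- The projection of the universal short-closed covering. -/
def universalProj (hr : 2 ≤ r) : universalCover G hr →g G where
  toFun x := x.vertex
  map_rel' := by
    rintro _ _ ⟨C, b, c, w, h, rfl, rfl⟩
    exact h

theorem universalProj_isLocallyBijective (hr : 2 ≤ r) :
    IsLocallyBijective (universalProj G hr) := by
  intro x
  obtain ⟨C, b, w, rfl⟩ := x.exists_eq_ofWalk
  refine ⟨fun y hy => (universalProj G hr).map_adj hy, fun y hy z hz e => ?_, fun c hc => ?_⟩
  · obtain ⟨c, h, rfl⟩ := (universalCover_adj_ofWalk hr w y).1 hy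
    obtain ⟨c', h', rfl⟩ := (universalCover_adj_ofWalk hr w z).1 hz
    obtain rfl : c = c' := e
    rfl
  · exact ⟨.ofWalk r (w.concat hc), (universalCover_adj_ofWalk hr w _).2 ⟨c, hc, rfl⟩, rfl⟩

theorem reachable_ofWalk_append (hr : 2 ≤ r) {C : G.ConnectedComponent} {b c : V}
    (w : G.Walk (root C) b) (v : G.Walk b c) :
    (universalCover G hr).Reachable (.ofWalk r w) (.ofWalk r (w.append v)) := by
  induction v with
  | nil => simp
  | cons h v ih =>
    have h1 : (universalCover G hr).Adj (.ofWalk r w) (.ofWalk r (w.concat h)) :=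
      (universalCover_adj_ofWalk hr w _).2 ⟨_, h, rfl⟩
    simpa [Walk.concat_append] using h1.reachable.trans (ih (w.concat h))

theorem eq_ofWalk_append (hr : 2 ≤ r) {x y : UniversalVertex G r} (v : (universalCover G hr).Walk x y)
    {C : G.ConnectedComponent} (w : G.Walk (root C) (universalProj G hr x)) (hx : x = .ofWalk r w) :
    y = .ofWalk r (w.append (v.map (universalProj G hr))) := by
  induction v with
  | nil => simpa using hx
  | @cons x y z h v ih =>
    have h' := h
    rw [hx, universalCover_adj_ofWalk] at h'
    obtain ⟨c, hc, rfl⟩ := h'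
    exact (ih (w.concat hc) rfl).trans (congrArg _ (Walk.concat_append _ _ _))

theorem universalProj_isShortClosed (hr : 2 ≤ r) : IsShortClosed r (universalProj G hr) := by
  intro y z v hv e
  obtain ⟨C, b, w, rfl⟩ := y.exists_eq_ofWalk
  have hz := eq_ofWalk_append hr v w rfl
  -- The equality of the projected ends can be substituted only after the projected walk and its end
  -- are generalised, since the type of the walk depends on that end.
  revert hz e
  have hl : (v.map (universalProj G hr)).length ≤ r := by rwa [Walk.length_map]
  generalize v.map (universalProj G hr) = t at hl
  revert t
  generalize universalProj G hr z = c
  rintro t hl ⟨⟩ rfl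
  have := (ShortHomotopic.refl w).append (ShortHomotopic.short (r := r) .nil t (by simpa))
  have hw : w.append .nil = w := Walk.append_nil w
  exact UniversalVertex.ofWalk_eq_ofWalk_iff.2 (hw ▸ this :)

theorem connectedComponentMk_root (C : G.ConnectedComponent) :
    G.connectedComponentMk (root C) = C :=
  Quot.out_eq C

theorem reachable_root (b : V) : G.Reachable (root (G.connectedComponentMk b)) b :=
  ConnectedComponent.exact (connectedComponentMk_root _)

theorem universalProj_isCovering (hr : 2 ≤ r) : IsCovering (universalProj G hr) := by
  refine isCovering_iff.2 ⟨fun b => ?_, universalProj_isLocallyBijective hr, fun x y hxy => ?_⟩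
  · obtain ⟨w⟩ := reachable_root (G := G) b
    exact ⟨.ofWalk r w, rfl⟩
  · obtain ⟨C, b, w, rfl⟩ := x.exists_eq_ofWalk
    obtain ⟨C', b', w', rfl⟩ := y.exists_eq_ofWalk
    obtain rfl : C = C' := by
      rw [← connectedComponentMk_root C, ← connectedComponentMk_root C']
      exact ConnectedComponent.sound
        (w.reachable.trans (Reachable.trans hxy w'.reverse.reachable))
    have h1 := reachable_ofWalk_append (r := r) hr (Walk.nil : G.Walk (root C) (root C)) w
    have h2 := reachable_ofWalk_append (r := r) hr (Walk.nil : G.Walk (root C) (root C)) w'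
    simp only [Walk.nil_append] at h1 h2
    exact h1.symm.trans h2

/-- To map to another covering, choose a vertex over each root and send a class of walks to the end
of its lift from there. Homotopy invariance of endpoints makes this well defined. -/
theorem universalProj_isLocalCovering (hr : 2 ≤ r) : IsLocalCovering r (universalProj G hr) := by
  refine ⟨universalProj_isCovering hr, (universalProj_isShortClosed hr).isBallPreserving
    (universalProj_isLocallyBijective hr), fun U K p' hp' hbp => ?_⟩
  obtain ⟨hs, hb, -⟩ := isCovering_iff.1 hp'
  have hsc := hbp.isShortClosed hb
  choose k hk using fun C : G.ConnectedComponent => hs (root C)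
  let F (C : G.ConnectedComponent) (b : V) :
      Quot (ShortHomotopic r : G.Walk (root C) b → G.Walk (root C) b → Prop) → p' ⁻¹' {b} :=
    Quot.lift (fun w => endpoint hb w ⟨k C, hk C⟩) fun _ _ h => h.endpoint_eq hb hsc _
  let q : universalCover G hr →g K :=
    { toFun := fun x => F x.1 x.2 x.3
      map_rel' := by
        rintro _ _ ⟨C, b, c, w, h, rfl, rfl⟩
        exact adj_endpoint_concat hb w h _ }
  have hq : p'.comp q = universalProj G hr := by
    ext x
    exact (F x.1 x.2 x.3).2
  exact ⟨q, (universalProj_isCovering hr).of_comp hp' hq, hq⟩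

/-- The projections of the closed walks of a local cover are null-homotopic. -/
theorem IsLocalCovering.shortHomotopic_nil {W : Type v} {H : SimpleGraph W} {p : H →g G}
    (hr : 2 ≤ r) (hp : IsLocalCovering r p) {y : W} (c : H.Walk y y) :
    ShortHomotopic r (c.map p) .nil := by
  obtain ⟨q, -, rfl⟩ := hp.universal _ _ _ (universalProj_isCovering hr)
    (universalProj_isLocalCovering hr).isBallPreserving
  obtain ⟨C, b, w, hw⟩ := (q y).exists_eq_ofWalk
  obtain rfl : universalProj G hr (q y) = b := by rw [hw]; rfl
  have h1 := eq_ofWalk_append hr (c.map q) w hw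
  have h2 : ShortHomotopic r w (w.append (c.map ((universalProj G hr).comp q))) := by
    rw [Walk.map_map] at h1
    exact UniversalVertex.ofWalk_eq_ofWalk_iff.1 (hw.symm.trans h1)
  exact h2.nil_of_append hr

end Universal

/-! ### Sums along walks, and potentials. -/

section WalkSum

variable {V : Type*} {G : SimpleGraph V} {A : Type*} [AddCommGroup A]

/-- The sum of a function of two vertices along a walk. -/
def walkSum (f : V → V → A) : ∀ {a b : V}, G.Walk a b → A
  | _, _, .nil => 0
  | _, _, .cons (u := a) (v := b) _ w => f a b + walkSum f w

variable (f : V → V → A)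

@[simp]
theorem walkSum_nil {a : V} : walkSum f (.nil : G.Walk a a) = 0 := rfl

@[simp]
theorem walkSum_cons {a b c : V} (h : G.Adj a b) (w : G.Walk b c) :
    walkSum f (.cons h w) = f a b + walkSum f w := rfl

@[simp]
theorem walkSum_append {a b c : V} (w : G.Walk a b) (w' : G.Walk b c) :
    walkSum f (w.append w') = walkSum f w + walkSum f w' := by
  induction w with
  | nil => simp
  | cons h w ih => simp [ih, add_assoc]

variable {f}

theorem walkSum_reverse (hf : ∀ a b, G.Adj a b → f a b + f b a = 0) {a b : V} (w : G.Walk a b) :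
    walkSum f w.reverse = -walkSum f w := by
  induction w with
  | nil => simp
  | cons h w ih =>
    simp only [Walk.reverse_cons, walkSum_append, ih, walkSum_cons, walkSum_nil, add_zero, neg_add]
    rw [eq_neg_of_add_eq_zero_right (hf _ _ h), add_comm]

/-- A walk that is not a path contains a nontrivial closed walk. -/
theorem exists_eq_append_of_not_isPath {a b : V} (w : G.Walk a b) (hw : ¬ w.IsPath) :
    ∃ (x : V) (w₁ : G.Walk a x) (w₂ : G.Walk x x) (w₃ : G.Walk x b),
      w = w₁.append (w₂.append w₃) ∧ 0 < w₂.length := by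
  classical
  induction w with
  | nil => simp at hw
  | @cons a c b h w ih =>
    by_cases hp : w.IsPath
    · have ha : a ∈ w.support := by
        by_contra ha
        exact hw (Walk.cons_isPath_iff _ _ |>.2 ⟨hp, ha⟩)
      exact ⟨a, .nil, .cons h (w.takeUntil a ha), w.dropUntil a ha, by simp, by simp⟩
    · obtain ⟨x, w₁, w₂, w₃, rfl, h2⟩ := ih hp
      exact ⟨x, .cons h w₁, w₂, w₃, by simp, h2⟩

theorem two_le_length_of_not_mem_edges {a b : V} (w : G.Walk a b) (hab : a ≠ b)
    (he : s(a, b) ∉ w.edges) : 2 ≤ w.length := by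
  match w with
  | .nil => exact absurd rfl hab
  | .cons h .nil => simp at he
  | .cons h (.cons h' w) => simp

/-- A cocycle on the triangles has zero sum along the short closed walks of a graph without short
chordless cycles. -/
theorem walkSum_eq_zero_of_isChordalUpTo {V : Type u} {G : SimpleGraph V} {f : V → V → A} {n : ℕ}
    (hf : ∀ a b, G.Adj a b → f a b + f b a = 0)
    (ht : ∀ a b c, G.Adj a b → G.Adj b c → G.Adj c a → f a b + f b c + f c a = 0)
    (hG : IsChordalUpTo n G) {a : V} (c : G.Walk a a) (hc : c.length ≤ n) : walkSum f c = 0 := by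
  classical
  induction hm : c.length using Nat.strong_induction_on generalizing a with
  | _ m ih =>
  replace ih : ∀ {x : V} (c : G.Walk x x), c.length < m → walkSum f c = 0 :=
    fun c h => ih _ h c (by omega) rfl
  by_cases hcyc : c.IsCycle
  · by_cases h4 : 4 ≤ c.length
    · obtain ⟨e, he⟩ := hG a c hcyc h4 hc
      induction e with
      | _ x y =>
      obtain ⟨hxy, hne, hx, hy⟩ := Walk.isChord_sym2Mk.1 he
      have hsum : walkSum f (c.rotate x hx) = walkSum f c := by
        rw [Walk.rotate, walkSum_append, add_comm, ← walkSum_append, Walk.take_spec]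
      have hy' : y ∈ (c.rotate x hx).support := by
        simpa using hy
      have hlen : (c.rotate x hx).length = c.length := by simp
      have hne' : s(x, y) ∉ (c.rotate x hx).edges := by
        rwa [(c.rotate_edges x hx).perm.mem_iff]
      rw [← hsum]
      generalize c.rotate x hx = d at hy' hlen hne'
      rw [← d.take_spec hy'] at hne' hlen ⊢
      generalize d.takeUntil y hy' = w at *
      generalize d.dropUntil y hy' = w' at *
      rw [Walk.edges_append, List.mem_append, not_or] at hne'
      have h1 := two_le_length_of_not_mem_edges w hxy.ne hne'.1
      have h2 := two_le_length_of_not_mem_edges w' hxy.ne' (by rw [Sym2.eq_swap]; exact hne'.2)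
      rw [Walk.length_append] at hlen
      -- The chord closes each arc. Both arcs have length at least 2, so both closed walks are
      -- shorter than the cycle, and the contributions of the chord cancel.
      have e1 := ih (.cons hxy.symm w) (by simp; omega)
      have e2 := ih (.cons hxy w') (by simp; omega)
      rw [walkSum_cons] at e1 e2
      rw [walkSum_append, eq_neg_of_add_eq_zero_right e1, eq_neg_of_add_eq_zero_right e2,
        ← neg_add, add_comm, hf _ _ hxy, neg_zero]
    · have h3 := hcyc.three_le_length
      match c with
      | .cons h (.cons h' (.cons h'' .nil)) => simpa [add_assoc] using ht _ _ _ h h' h''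
      | .cons h (.cons h' (.cons h'' (.cons _ w))) => simp at h4
  · match c with
    | .nil => rfl
    | .cons h w =>
      by_cases hw : w.IsPath
      · rcases w with _ | ⟨h', _ | ⟨h'', w'⟩⟩
        · exact absurd rfl h.ne
        · simpa using hf _ _ h
        · exact absurd
            (Walk.isCycle_iff_isPath_tail_and_le_length.2 ⟨by simpa using hw, by simp⟩) hcyc
      · obtain ⟨x, w₁, w₂, w₃, rfl, h2⟩ := exists_eq_append_of_not_isPath w hw
        simp only [Walk.length_cons, Walk.length_append] at hm
        have e1 := ih (.cons h (w₁.append w₃)) (by simp; omega)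
        have e2 := ih w₂ (by omega)
        simp only [walkSum_cons, walkSum_append] at e1 ⊢
        rw [e2, zero_add, e1]

theorem exists_potential (hf : ∀ a b, G.Adj a b → f a b + f b a = 0)
    (hz : ∀ (a : V) (c : G.Walk a a), walkSum f c = 0) :
    ∃ g : V → A, ∀ a b, G.Adj a b → f a b = g b - g a := by
  let o (a : V) : V := Quot.out (G.connectedComponentMk a)
  have ho (a : V) : Nonempty (G.Walk (o a) a) := ConnectedComponent.exact (Quot.out_eq _)
  let w (a : V) : G.Walk (o a) a := (ho a).some
  -- The starts are separate variables because the roots chosen for adjacent vertices are equal only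
  -- propositionally.
  have key : ∀ (x y a b : V) (h : G.Adj a b) (s : G.Walk x a) (t : G.Walk y b), x = y →
      f a b = walkSum f t - walkSum f s := by
    rintro x _ a b h s t rfl
    have := hz _ (s.append (.cons h t.reverse))
    rw [walkSum_append, walkSum_cons, walkSum_reverse hf] at this
    rw [← sub_eq_zero, ← this]
    abel
  exact ⟨fun a => walkSum f (w a), fun a b h => key _ _ a b h _ _
    (congrArg Quot.out (ConnectedComponent.sound h.reachable))⟩

end WalkSum

/-! ### Chordless cycles, cycle graphs and wheels. -/

section Cycle

variable {V : Type u} {G : SimpleGraph V}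

theorem cycleGraph_adj_iff_val {n : ℕ} (hn : 3 ≤ n) {i j : Fin n} : (cycleGraph n).Adj i j ↔
    i.val + 1 = j.val ∨ j.val + 1 = i.val ∨ (i.val = 0 ∧ j.val + 1 = n) ∨
      (j.val = 0 ∧ i.val + 1 = n) := by
  rw [cycleGraph_adj', Fin.sub_def, Fin.sub_def]
  obtain ⟨i, hi⟩ := i
  obtain ⟨j, hj⟩ := j
  simp only
  have aux : ∀ a b, a < n → b < n → ((n - b + a) % n = 1 ↔ b + 1 = a ∨ a = 0 ∧ b + 1 = n) := by
    intro a b ha hb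
    by_cases h : b ≤ a
    · rw [show n - b + a = n + (a - b) by omega, Nat.add_mod_left, Nat.mod_eq_of_lt (by omega)]
      omega
    · rw [Nat.mod_eq_of_lt (by omega)]
      omega
  rw [aux i j hi hj, aux j i hj hi]
  omega

theorem mem_edges_iff_cycleGraph_adj {u : V} {c : G.Walk u u} (hc : c.IsCycle)
    (i j : Fin c.length) :
    s(c.getVert i, c.getVert j) ∈ c.edges ↔ (cycleGraph c.length).Adj i j := by
  have h3 := hc.three_le_length
  rw [cycleGraph_adj_iff_val h3]
  have inj : ∀ {a b : ℕ}, a < c.length → b < c.length → c.getVert a = c.getVert b → a = b :=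
    fun ha hb h => hc.getVert_injOn' (by simp; omega) (by simp; omega) h
  have aux : ∀ {k b : ℕ}, k < c.length → b < c.length → c.getVert (k + 1) = c.getVert b →
      k + 1 = b ∨ b = 0 ∧ k + 1 = c.length := by
    intro k b hk hb h
    by_cases hk' : k + 1 = c.length
    · rw [hk', c.getVert_length] at h
      exact .inr ⟨(inj (by omega) hb (c.getVert_zero.trans h)).symm, hk'⟩
    · exact .inl (inj (by omega) hb h)
  have hend : ∀ {k : ℕ}, k + 1 = c.length → c.getVert (k + 1) = c.getVert 0 := fun h => by
    rw [h, c.getVert_length, c.getVert_zero]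
  obtain ⟨i, hi⟩ := i
  obtain ⟨j, hj⟩ := j
  rw [Walk.mk_mem_edges_iff_exists]
  simp only [Sym2.eq_iff]
  constructor
  · rintro ⟨k, hk, ⟨h1, h2⟩ | ⟨h1, h2⟩⟩
    · have := inj hk hi h1
      have := aux hk hj h2
      omega
    · have := inj hk hj h1
      have := aux hk hi h2
      omega
  · rintro (rfl | rfl | ⟨rfl, h⟩ | ⟨rfl, h⟩)
    · exact ⟨i, hi, .inl ⟨rfl, rfl⟩⟩
    · exact ⟨j, hj, .inr ⟨rfl, rfl⟩⟩
    · exact ⟨j, hj, .inr ⟨rfl, hend h⟩⟩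
    · exact ⟨i, hi, .inl ⟨rfl, hend h⟩⟩

theorem exists_getVert_of_mem_support {u x : V} {c : G.Walk u u} (hc : c.IsCycle)
    (hx : x ∈ c.support) : ∃ i : Fin c.length, c.getVert i = x := by
  have h3 := hc.three_le_length
  obtain ⟨k, rfl, hk⟩ := Walk.mem_support_iff_exists_getVert.1 hx
  rcases hk.lt_or_eq with h | rfl
  · exact ⟨⟨k, h⟩, rfl⟩
  · exact ⟨⟨0, by omega⟩, by simp⟩

/-- A chordless cycle is an induced copy of a cycle graph. -/
theorem exists_embedding_of_chordless {u : V} {c : G.Walk u u} (hc : c.IsCycle)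
    (hch : c.IsChordless) : ∃ φ : cycleGraph c.length ↪g G, ∀ i, φ i = c.getVert i := by
  refine ⟨⟨⟨fun i => c.getVert i, fun i j h => Fin.ext (hc.getVert_injOn' ?_ ?_ h)⟩, ?_⟩,
    fun i => rfl⟩
  · have := i.2; simp; omega
  · have := j.2; simp; omega
  · intro i j
    rw [← mem_edges_iff_cycleGraph_adj hc]
    exact ⟨fun h => hch.mem_edges (c.getVert_mem_support _) (c.getVert_mem_support _) h,
      fun h => c.adj_of_mem_edges h⟩

/-- A chordless cycle among the neighbours of `v` would be the rim of an induced wheel with hub `v`.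
-/
theorem IsWheelFree.isChordal_induce (hG : IsWheelFree G) {v : V} {s : Set V}
    (hs : s ⊆ G.neighborSet v) : IsChordal (G.induce s) := by
  intro x c hc h4
  by_contra hch
  obtain ⟨φ, -⟩ := exists_embedding_of_chordless hc (fun e he => hch ⟨e, he⟩)
  refine hG c.length h4 ⟨⟨⟨fun i => i.elim v fun i => (φ i : V), ?_⟩, ?_⟩⟩
  · rintro (_ | i) (_ | j) h
    · rfl
    · exact absurd h (G.ne_of_adj (hs (φ j).2))
    · exact absurd h.symm (G.ne_of_adj (hs (φ i).2))
    · exact congrArg some (φ.injective (Subtype.ext h))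
  · rintro (_ | i) (_ | j)
    · exact iff_of_false (G.irrefl) id
    · exact iff_of_true (hs (φ j).2) trivial
    · exact iff_of_true (G.adj_symm (hs (φ i).2)) trivial
    · exact φ.map_adj_iff (v := i) (w := j)

theorem cycleGraph_cycle_isChordless (n : ℕ) : (cycleGraph.cycle n).IsChordless := by
  have key : ∀ i : Fin (n + 3), ∃ k : Fin (cycleGraph.cycle n).length,
      (cycleGraph.cycle n).getVert k = i := fun i => exists_getVert_of_mem_support
    cycleGraph.isCycle_cycle (by
      rw [Walk.mem_support_iff_exists_getVert]
      -- The standard cycle runs through its vertices in decreasing order, starting from 0.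
      refine ⟨n + 3 - i, ?_, by simp⟩
      rw [cycleGraph.getVert_cycle (by omega)]
      have := i.2
      ext
      simp only [show n + 3 - (n + 3 - i.val) = i.val by omega, Nat.mod_eq_of_lt this])
  have val : ∀ k : Fin (cycleGraph.cycle n).length,
      ((cycleGraph.cycle n).getVert k).val = if k.val = 0 then 0 else n + 3 - k := by
    intro k
    have hk := k.2.trans_eq cycleGraph.length_cycle
    rw [cycleGraph.getVert_cycle hk.le]
    split_ifs with h
    · simp [h]
    · exact Nat.mod_eq_of_lt (by omega)
  rw [Walk.isChordless_iff_forall_mem_edges]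
  intro i j _ _ hij
  obtain ⟨k, rfl⟩ := key i
  obtain ⟨l, rfl⟩ := key j
  rw [mem_edges_iff_cycleGraph_adj cycleGraph.isCycle_cycle, cycleGraph_adj_iff_val (by simp)]
  rw [cycleGraph_adj_iff_val (by simp), val, val] at hij
  have hk := k.2
  have hl := l.2
  have hlen := cycleGraph.length_cycle (n := n)
  split_ifs at hij <;> (try simp only [false_or] at hij) <;> omega

theorem IsChordal.isWheelFree (hG : IsChordal G) : IsWheelFree G := by
  rintro n hn ⟨φ⟩
  obtain ⟨m, rfl⟩ : ∃ m, n = m + 3 := ⟨n - 3, by omega⟩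
  let ψ : cycleGraph (m + 3) ↪g G :=
    ⟨⟨fun i => φ (some i), fun i j h => Option.some_injective _ (φ.injective h)⟩,
      φ.map_adj_iff⟩
  obtain ⟨e, he⟩ := hG _ ((cycleGraph.cycle m).map ψ.toHom)
    ((Walk.isCycle_map_iff_of_injective ψ.injective).2 cycleGraph.isCycle_cycle)
    (by simpa using hn)
  induction e with
  | _ x y =>
  obtain ⟨hxy, hne, hx, hy⟩ := Walk.isChord_sym2Mk.1 he
  rw [Walk.support_map, List.mem_map] at hx hy
  obtain ⟨i, hi, rfl⟩ := hx
  obtain ⟨j, hj, rfl⟩ := hy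
  refine hne ?_
  rw [Walk.edges_map]
  exact List.mem_map_of_mem (f := Sym2.map _) ((cycleGraph_cycle_isChordless m).mem_edges hi hj
    (ψ.map_adj_iff.1 hxy))

end Cycle

/-! ### Extending cocycles in wheel-free graphs. -/

section Cocycle

variable {V : Type u} {G : SimpleGraph V} {A : Type*} [AddCommGroup A]

variable (G A) in
/-- A cocycle, with respect to the triangles, on an induced subgraph. -/
structure PartialCocycle where
  /-- The vertices of the subgraph. -/
  carrier : Set V
  /-- The values on the oriented edges. -/
  toFun : V → V → A
  antisymm : ∀ a ∈ carrier, ∀ b ∈ carrier, G.Adj a b → toFun a b + toFun b a = 0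
  triangle : ∀ a ∈ carrier, ∀ b ∈ carrier, ∀ c ∈ carrier, G.Adj a b → G.Adj b c → G.Adj c a →
    toFun a b + toFun b c + toFun c a = 0

instance : Preorder (PartialCocycle G A) where
  le f g := f.carrier ⊆ g.carrier ∧ ∀ a ∈ f.carrier, ∀ b ∈ f.carrier, f.toFun a b = g.toFun a b
  le_refl f := ⟨subset_rfl, fun _ _ _ _ => rfl⟩
  le_trans f g h hfg hgh := ⟨hfg.1.trans hgh.1, fun a ha b hb =>
    (hfg.2 a ha b hb).trans (hgh.2 a (hfg.1 ha) b (hfg.1 hb))⟩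

theorem PartialCocycle.exists_upperBound (S : Set (PartialCocycle G A)) (hS : IsChain (· ≤ ·) S) :
    ∃ ub : PartialCocycle G A, ∀ f ∈ S, f ≤ ub := by
  classical
  -- Members of a chain agree where both are defined, so the choice is immaterial. Any two vertices
  -- of the union lie in a common carrier, so the default 0 plays no role there.
  let F (a b : V) : A := if h : ∃ f ∈ S, a ∈ f.carrier ∧ b ∈ f.carrier then
    h.choose.toFun a b else 0
  have hF : ∀ f ∈ S, ∀ a ∈ f.carrier, ∀ b ∈ f.carrier, F a b = f.toFun a b := by
    intro f hf a ha b hb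
    have h : ∃ f ∈ S, a ∈ f.carrier ∧ b ∈ f.carrier := ⟨f, hf, ha, hb⟩
    obtain ⟨h1, h2, h3⟩ := h.choose_spec
    simp only [F, dif_pos h]
    rcases hS.total h1 hf with hle | hle
    · exact hle.2 a h2 b h3
    · exact (hle.2 a ha b hb).symm
  have two : ∀ f ∈ S, ∀ g ∈ S, ∃ k ∈ S, f ≤ k ∧ g ≤ k := fun f hf g hg => by
    rcases hS.total hf hg with h | h
    · exact ⟨g, hg, h, le_rfl⟩
    · exact ⟨f, hf, le_rfl, h⟩
  refine ⟨⟨{a | ∃ f ∈ S, a ∈ f.carrier}, F, ?_, ?_⟩, fun f hf =>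
    ⟨fun a ha => ⟨f, hf, ha⟩, fun a ha b hb => (hF f hf a ha b hb).symm⟩⟩
  · rintro a ⟨f, hf, ha⟩ b ⟨g, hg, hb⟩ hab
    obtain ⟨k, hk, hfk, hgk⟩ := two f hf g hg
    rw [hF k hk a (hfk.1 ha) b (hgk.1 hb), hF k hk b (hgk.1 hb) a (hfk.1 ha)]
    exact k.antisymm a (hfk.1 ha) b (hgk.1 hb) hab
  · rintro a ⟨f, hf, ha⟩ b ⟨g, hg, hb⟩ c ⟨h, hh, hc⟩ hab hbc hca
    obtain ⟨k', hk', hfk, hgk⟩ := two f hf g hg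
    obtain ⟨k, hk, hkk, hhk⟩ := two k' hk' h hh
    replace ha := hkk.1 (hfk.1 ha)
    replace hb := hkk.1 (hgk.1 hb)
    replace hc := hhk.1 hc
    rw [hF k hk a ha b hb, hF k hk b hb c hc, hF k hk c hc a ha]
    exact k.triangle a ha b hb c hc hab hbc hca

/-- The triangle condition at `v` says exactly that the values on the edges leaving `v` form a
potential for `f` on the neighbours of `v` in the carrier. These induce a chordal graph, so a
potential exists. -/
theorem PartialCocycle.exists_insert (hG : IsWheelFree G) (f : PartialCocycle G A) {v : V}
    (hv : v ∉ f.carrier) : ∃ g : PartialCocycle G A, f ≤ g ∧ v ∈ g.carrier := by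
  classical
  let s : Set V := f.carrier ∩ G.neighborSet v
  have hanti : ∀ a b : s, (G.induce s).Adj a b → f.toFun a b + f.toFun b a = 0 :=
    fun a b h => f.antisymm a a.2.1 b b.2.1 h
  have hch : IsChordal (G.induce s) := hG.isChordal_induce Set.inter_subset_right
  obtain ⟨g, hg⟩ := exists_potential (f := fun a b : s => f.toFun a b) hanti fun a c =>
    -- Chordality holds for all lengths, so the bound is taken to be the length of `c` itself.
    walkSum_eq_zero_of_isChordalUpTo hanti
      (fun a b c h1 h2 h3 => f.triangle a a.2.1 b b.2.1 c c.2.1 h1 h2 h3)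
      (fun x d hd h4 _ => hch x d hd h4) c le_rfl
  let g' (a : V) : A := if h : a ∈ s then g ⟨a, h⟩ else 0
  have hg' : ∀ a ∈ f.carrier, ∀ b ∈ f.carrier, G.Adj v a → G.Adj v b → G.Adj a b →
      f.toFun a b = g' b - g' a := by
    intro a ha b hb hva hvb hab
    have ha' : a ∈ s := ⟨ha, hva⟩
    have hb' : b ∈ s := ⟨hb, hvb⟩
    simp only [g', dif_pos ha', dif_pos hb']
    exact hg ⟨a, ha'⟩ ⟨b, hb'⟩ hab
  let F (a b : V) : A := if a = v then g' b else if b = v then -g' a else f.toFun a b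
  have hne : ∀ a ∈ f.carrier, a ≠ v := fun a ha h => hv (h ▸ ha)
  have F1 : ∀ b, F v b = g' b := fun b => by simp [F]
  have F2 : ∀ a, a ≠ v → F a v = -g' a := fun a ha => by simp [F, ha]
  have F3 : ∀ a ∈ f.carrier, ∀ b ∈ f.carrier, F a b = f.toFun a b := fun a ha b hb => by
    simp [F, hne a ha, hne b hb]
  refine ⟨⟨insert v f.carrier, F, ?_, ?_⟩, ⟨Set.subset_insert _ _, fun a ha b hb =>
    (F3 a ha b hb).symm⟩, Set.mem_insert _ _⟩
  · rintro a (rfl | ha) b (rfl | hb) hab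
    · exact absurd rfl hab.ne
    · rw [F1, F2 b (hne b hb), add_neg_cancel]
    · rw [F1, F2 a (hne a ha), neg_add_cancel]
    · rw [F3 a ha b hb, F3 b hb a ha]
      exact f.antisymm a ha b hb hab
  · rintro a (rfl | ha) b (rfl | hb) c (rfl | hc) hab hbc hca
    · exact absurd rfl hab.ne
    · exact absurd rfl hab.ne
    · exact absurd rfl hca.ne
    · rw [F1, F3 b hb c hc, F2 c (hne c hc), hg' b hb c hc hab hca.symm hbc]
      abel
    · exact absurd rfl hbc.ne
    · rw [F1, F2 a (hne a ha), F3 c hc a ha, hg' c hc a ha hbc hab.symm hca]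
      abel
    · rw [F1, F2 b (hne b hb), F3 a ha b hb, hg' a ha b hb hca hbc.symm hab]
      abel
    · rw [F3 a ha b hb, F3 b hb c hc, F3 c hc a ha]
      exact f.triangle a ha b hb c hc hab hbc hca

/-- In a wheel-free graph, cocycles on induced subgraphs extend to the whole graph. -/
theorem PartialCocycle.exists_extension (hG : IsWheelFree G) (f : PartialCocycle G A) :
    ∃ g : PartialCocycle G A, f ≤ g ∧ g.carrier = Set.univ := by
  obtain ⟨g, hfg, hg⟩ := zorn_le_nonempty_Ici₀ f
    (fun S _ hS _ _ => exists_upperBound S hS) f le_rfl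
  refine ⟨g, hfg, Set.eq_univ_of_forall fun v => ?_⟩
  by_contra hv
  obtain ⟨k, hgk, hk⟩ := g.exists_insert hG hv
  exact hv ((hg hgk).1 hk)

/-- The cocycle on a chordless cycle of length at least four that is supported on its first
edge. -/
theorem exists_partialCocycle_of_chordless {u : V} {c : G.Walk u u} (hc : c.IsCycle)
    (h4 : 4 ≤ c.length) (hch : c.IsChordless) :
    ∃ f : PartialCocycle G ℤ, f.carrier = {x | x ∈ c.support} ∧ walkSum f.toFun c = 1 := by
  classical
  let i0 : Fin c.length := ⟨0, by omega⟩
  let i1 : Fin c.length := ⟨1, by omega⟩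
  have h01 : c.getVert i0 ≠ c.getVert i1 := fun h => by
    have := hc.getVert_injOn' (by simp [i0]) (by simp [i1]; omega) h
    simp [i0, i1] at this
  -- Length at least 4 enters here: the first edge lies in no triangle on the cycle, so the triangle
  -- condition is trivial.
  have no : ∀ x ∈ c.support, G.Adj (c.getVert i1) x → ¬ G.Adj x (c.getVert i0) := by
    intro x hx h1 h2
    obtain ⟨j, rfl⟩ := exists_getVert_of_mem_support hc hx
    obtain ⟨φ, hφ⟩ := exists_embedding_of_chordless hc hch
    rw [← hφ, ← hφ, φ.map_adj_iff, cycleGraph_adj_iff_val (by omega)] at h1 h2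
    simp only [i0, i1] at h1 h2
    omega
  let f (a b : V) : ℤ := (if a = c.getVert i0 ∧ b = c.getVert i1 then 1 else 0) -
    if a = c.getVert i1 ∧ b = c.getVert i0 then 1 else 0
  have hf : ∀ a b, s(a, b) ≠ s(c.getVert i0, c.getVert i1) → f a b = 0 := by
    intro a b h
    rw [Ne, Sym2.eq_iff, not_or] at h
    simp only [f, if_neg h.1, if_neg h.2, sub_zero]
  refine ⟨⟨{x | x ∈ c.support}, f, fun a _ b _ _ => ?_, fun a ha b hb d hd hab hbd hda => ?_⟩,
    rfl, ?_⟩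
  · simp only [f, and_comm (a := b = _)]
    ring
  · have key : ∀ a ∈ c.support, ∀ b ∈ c.support, ∀ d ∈ c.support, G.Adj a b → G.Adj b d →
        G.Adj d a → f a b = 0 := by
      intro a ha b hb d hd hab hbd hda
      refine hf a b fun h => ?_
      rcases Sym2.eq_iff.1 h with ⟨rfl, rfl⟩ | ⟨rfl, rfl⟩
      · exact no d hd hbd hda
      · exact no d hd hda.symm hbd.symm
    rw [key a ha b hb d hd hab hbd hda, key b hb d hd a ha hbd hda hab,
      key d hd a ha b hb hda hab hbd]
    rfl
  · change walkSum f c = 1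
    have hsum : ∀ {x y : V} (w : G.Walk x y), s(c.getVert i0, c.getVert i1) ∉ w.edges →
        walkSum f w = 0 := by
      intro x y w
      induction w with
      | nil => simp
      | cons h w ih =>
        intro hw
        rw [Walk.edges_cons, List.mem_cons, not_or] at hw
        rw [walkSum_cons, hf _ _ (Ne.symm hw.1), ih hw.2, add_zero]
    have h1 : f (c.getVert i0) (c.getVert i1) = 1 := by simp [f, h01]
    have e := c.cons_tail_eq hc.not_nil
    have hc' := hc
    rw [← e] at hc'
    -- A cycle uses its first edge only once, so the tail contributes nothing.
    have h2 := hsum c.tail (by simpa [i0, i1] using ((Walk.cons_isCycle_iff _ _).1 hc').2)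
    simp only [i0, i1, Walk.getVert_zero] at h1
    rw [← congrArg (walkSum f) e, walkSum_cons, h2, add_zero]
    exact h1

end Cocycle

/-! ### Voltage graphs. -/

section CyclicCover

variable {W : Type*} {A : Type*} [AddCommGroup A]

/-- The covering of a graph with fibre `A` whose sheets are exchanged according to `f`. -/
def voltageGraph (H : SimpleGraph W) (f : W → W → A) : SimpleGraph (W × A) where
  Adj x y := H.Adj x.1 y.1 ∧ y.2 = x.2 + f x.1 y.1 ∧ x.2 = y.2 + f y.1 x.1
  symm := ⟨fun _ _ h => ⟨h.1.symm, h.2.2, h.2.1⟩⟩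
  loopless := ⟨fun _ h => h.1.ne rfl⟩

/-- The projection of the voltage graph. -/
def voltageProj (H : SimpleGraph W) (f : W → W → A) : voltageGraph H f →g H where
  toFun := Prod.fst
  map_rel' h := h.1

variable {H : SimpleGraph W} {f : W → W → A}

theorem voltageGraph_adj (hf : ∀ a b, H.Adj a b → f a b + f b a = 0) {a b : W}
    (h : H.Adj a b) (s : A) : (voltageGraph H f).Adj (a, s) (b, s + f a b) :=
  ⟨h, rfl, by simp [add_assoc, hf a b h]⟩

theorem voltageProj_isLocallyBijective (hf : ∀ a b, H.Adj a b → f a b + f b a = 0) :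
    IsLocallyBijective (voltageProj H f) := by
  rintro ⟨a, s⟩
  refine ⟨fun y hy => hy.1, ?_, fun b hb => ⟨_, voltageGraph_adj hf hb s, rfl⟩⟩
  rintro ⟨b, t⟩ hb ⟨b', t'⟩ hb' (rfl : b = b')
  exact Prod.ext rfl (hb.2.1.trans hb'.2.1.symm)

theorem voltageGraph_snd_eq {x y : W × A} (w : (voltageGraph H f).Walk x y) :
    y.2 = x.2 + walkSum f (w.map (voltageProj H f)) := by
  induction w with
  | nil => simp
  | cons h w ih =>
    rw [ih, Walk.map_cons, walkSum_cons, ← add_assoc, h.2.1]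
    rfl

theorem exists_voltageGraph_walk (hf : ∀ a b, H.Adj a b → f a b + f b a = 0) {a b : W}
    (w : H.Walk a b) (s : A) : ∃ (t : A) (v : (voltageGraph H f).Walk (a, s) (b, t)),
      v.map (voltageProj H f) = w := by
  induction w generalizing s with
  | nil => exact ⟨s, .nil, rfl⟩
  | @cons a b c h w ih =>
    obtain ⟨t, v, hv⟩ := ih (s + f a b)
    exact ⟨t, .cons (voltageGraph_adj hf h s) v, congrArg (Walk.cons h) hv⟩

end CyclicCover

/-! ### Vanishing on local covers, and the theorem. -/

/-- In a local cover, functions with zero sums along the short closed walks have zero sums along all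
closed walks. -/
theorem IsLocalCovering.walkSum_eq_zero {V : Type u} {W : Type v} {G : SimpleGraph V}
    {H : SimpleGraph W} {p : H →g G} {r : ℕ} (hr : 2 ≤ r) (hp : IsLocalCovering r p)
    {A : Type*} [AddCommGroup A] {f : W → W → A} (hf : ∀ a b, H.Adj a b → f a b + f b a = 0)
    (hs : ∀ (a : W) (c : H.Walk a a), c.length ≤ r → walkSum f c = 0) {a : W} (c : H.Walk a a) :
    walkSum f c = 0 := by
  have hb : IsLocallyBijective p := hp.isCovering.bijOn_neighborSet
  have hsc := hp.isBallPreserving.isShortClosed hb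
  -- The voltage graph may be disconnected over a component, so `P` need not be a covering. Only
  -- local bijectivity and the lifting condition are needed.
  let P := p.comp (voltageProj H f)
  have hb' : IsLocallyBijective P := fun y =>
    (hb _).comp (voltageProj_isLocallyBijective hf y)
  have hsc' : IsShortClosed r P := by
    rintro ⟨y, s⟩ ⟨z, t⟩ w hw e
    have hl : (w.map (voltageProj H f)).length ≤ r := by rwa [Walk.length_map]
    obtain rfl : y = z := hsc y z (w.map (voltageProj H f)) hl e
    have h1 := voltageGraph_snd_eq w
    have h2 := hs y (w.map (voltageProj H f)) hl
    refine Prod.ext rfl ?_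
    exact (h1.trans ((congrArg (s + ·) h2).trans (add_zero s))).symm
  obtain ⟨t, v, hv⟩ := exists_voltageGraph_walk hf c 0
  have h1 := endpoint_map hb' v
  -- The projection of `c` to `G` is null-homotopic, so its lift returns to height 0. The final
  -- height is also the sum along `c`.
  have h2 := (hp.shortHomotopic_nil hr c).endpoint_eq hb' hsc' ⟨(a, (0 : A)), rfl⟩
  rw [endpoint_nil] at h2
  have h3 : v.map P = c.map p := (Walk.map_map _ _ _).symm.trans (congrArg (Walk.map p) hv)
  rw [h3] at h1
  have h4 : t = 0 := congrArg (fun x => x.1.2) (h1.symm.trans h2)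
  have h5 : t = 0 + walkSum f c :=
    (voltageGraph_snd_eq v).trans (congrArg (fun w => 0 + walkSum f w) hv)
  rw [← h4, h5, zero_add]

theorem IsLocalCovering.isChordal {V : Type u} {W : Type v} {G : SimpleGraph V}
    {H : SimpleGraph W} {p : H →g G} {r : ℕ} (hr : 2 ≤ r) (hp : IsLocalCovering r p)
    (hc : IsChordalUpTo r H) (hw : IsWheelFree H) : IsChordal H := by
  intro x c hcyc h4
  by_contra hch
  obtain ⟨f, hfc, hsum⟩ := exists_partialCocycle_of_chordless hcyc h4 (fun e he => hch ⟨e, he⟩)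
  obtain ⟨g, hfg, hg⟩ := f.exists_extension hw
  have hmem : ∀ a, a ∈ g.carrier := fun a => hg ▸ Set.mem_univ a
  have hanti : ∀ a b, H.Adj a b → g.toFun a b + g.toFun b a = 0 :=
    fun a b => g.antisymm a (hmem a) b (hmem b)
  have hzero := hp.walkSum_eq_zero hr hanti (fun a c hl => walkSum_eq_zero_of_isChordalUpTo hanti
    (fun a b c => g.triangle a (hmem a) b (hmem b) c (hmem c)) hc c hl) c
  have heq : ∀ {x y : W} (w : H.Walk x y), (∀ z ∈ w.support, z ∈ f.carrier) →
      walkSum g.toFun w = walkSum f.toFun w := by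
    intro x y w
    induction w with
    | nil => simp
    | cons h w ih =>
      intro hs
      simp only [Walk.support_cons, List.mem_cons, forall_eq_or_imp] at hs
      rw [walkSum_cons, walkSum_cons, ih hs.2, hfg.2 _ hs.1 _ (hs.2 _ w.start_mem_support)]
  rw [heq c (fun z hz => hfc ▸ hz), hsum] at hzero
  exact one_ne_zero hzero

end LocalCover

theorem mainTheorem5 {V : Type u} (G : SimpleGraph V) (r : ℕ) (hr : 3 ≤ r) :
    (∃ (W : Type u) (H : SimpleGraph W) (p : H →g G), LocalCover.IsLocalCovering r p) ∧
    ∀ (W : Type v) (H : SimpleGraph W) (p : H →g G), LocalCover.IsLocalCovering r p →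
      (LocalCover.IsChordal H ↔ LocalCover.IsChordalUpTo r H ∧ LocalCover.IsWheelFree H) := by
  have hr2 : 2 ≤ r := by omega
  exact ⟨⟨_, _, _, LocalCover.universalProj_isLocalCovering (G := G) hr2⟩, fun W H p hp =>
    ⟨fun h => ⟨fun x c hc h4 _ => h x c hc h4, h.isWheelFree⟩,
      fun h => hp.isChordal hr2 h.1 h.2⟩⟩
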